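/- Let $X=\mathbb F_3[x]/(x^3)$ with its standard derivation $\partial_x=d/dx$, and let $T(X)=\bigoplus_{n\ge0}X^{\otimes n}$. Define linear operators $a,t$ on $T(X)$ recursively by $a\cdot 1=t\cdot 1=0$ and, for $y\in X$ and $v\in T(X)$, $$a\cdot(y\otimes v)=\partial_x y\otimes v,\qquad t\cdot(y\otimes v)=xy\otimes(a\cdot v)+x^2y\otimes(t\cdot v),$$ that is, through the self-similarity structure $a\mapsto\partial_x$, $t\mapsto x\otimes a+x^2\otimes t$. The Gupta–Sidki Lie algebra $\mathcal L$ is the Lie algebra over $\mathbb F_3$ of operators on $T(X)$ generated by $a$ and $t$, with bracket the commutator. **Theorem.** $\mathcal L$ is closed under $z\mapsto z^3$, hence is a restricted Lie algebra over $\mathbb F_3$, and: 1. $\mathcal L$ is nil: for every $z\in\mathcal L$ there is $n$ with $z^{3^n}=0$, and for every $z\in\mathcal L$ the endomorphism $\operatorname{ad}(z)$ of $\mathcal L$ is nilpotent. 2. The nillity of $\mathcal L$ is unbounded: for every $n$ there is $z\in\mathcal L$ with $z^{3^n}\ne0$, and for every $n$ there is $z\in\mathcal L$ with $\operatorname{ad}(z)^n\neq0$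 on $\mathcal L$. 3. $\mathcal L$ is not a nilpotent Lie algebra. Moreover it is not PI: for every non-zero Lie polynomial $P$ over $\mathbb F_3$ (a non-zero element of the free Lie algebra on countably many indeterminates, viewed inside the free associative algebra) there are elements $z_0,z_1,\dots\in\mathcal L$ with $P(z_0,z_1,\dots)\ne0$. -/

import Mathlib

open scoped Polynomial

-- Associative algebras carry the commutator bracket.
attribute [local instance 100] LieRing.ofAssociativeRing

namespace GuptaSidki

noncomputable section

/-- The alphabet `X = 𝔽₃[x]/(x³)`. -/
abbrev Alphabet : Type := AdjoinRoot (Polynomial.X ^ 3 : (ZMod 3)[X])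

/-- The class of `x` in the alphabet. -/
def x : Alphabet := AdjoinRoot.root (Polynomial.X ^ 3 : (ZMod 3)[X])

/-- The ideal `(x³)` of `𝔽₃[x]` is stable under differentiation. -/
theorem mk_derivative_eq_zero (q : (ZMod 3)[X])
    (hq : AdjoinRoot.mkₐ (Polynomial.X ^ 3 : (ZMod 3)[X]) q = 0) :
    AdjoinRoot.mkₐ (Polynomial.X ^ 3 : (ZMod 3)[X]) (Polynomial.derivative' q) = 0 := by
  have h : AdjoinRoot.mk (Polynomial.X ^ 3 : (ZMod 3)[X]) q = 0 := hq
  rw [AdjoinRoot.mk_eq_zero] at h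
  obtain ⟨r, rfl⟩ := h
  change AdjoinRoot.mk (Polynomial.X ^ 3 : (ZMod 3)[X]) (Polynomial.derivative _) = 0
  rw [AdjoinRoot.mk_eq_zero, Polynomial.derivative_mul, Polynomial.derivative_X_pow]
  have h3 : ((3 : ℕ) : ZMod 3) = 0 := by decide
  rw [h3]
  simp

/-- The standard derivation `∂ₓ = d/dx` of `X = 𝔽₃[x]/(x³)`. -/
def dx : Derivation (ZMod 3) Alphabet Alphabet :=
  Derivation.liftOfSurjective
    (f := AdjoinRoot.mkₐ (Polynomial.X ^ 3 : (ZMod 3)[X]))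
    (AdjoinRoot.mk_surjective (g := (Polynomial.X ^ 3 : (ZMod 3)[X])))
    (d := Polynomial.derivative') mk_derivative_eq_zero

theorem dx_mk (q : (ZMod 3)[X]) :
    dx (AdjoinRoot.mk (Polynomial.X ^ 3 : (ZMod 3)[X]) q) =
      AdjoinRoot.mk (Polynomial.X ^ 3 : (ZMod 3)[X]) (Polynomial.derivative q) :=
  Derivation.liftOfSurjective_apply
    (f := AdjoinRoot.mkₐ (Polynomial.X ^ 3 : (ZMod 3)[X]))
    (AdjoinRoot.mk_surjective (g := (Polynomial.X ^ 3 : (ZMod 3)[X])))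
    (d := Polynomial.derivative') mk_derivative_eq_zero q

/-- The space `T(X)` on which the Lie algebra acts: the tensor algebra of the module `X`. -/
abbrev Tens : Type := TensorAlgebra (ZMod 3) Alphabet

/-- Left tensor multiplication by a letter `y`, as a linear function of `y`. -/
def consLetter : Alphabet →ₗ[ZMod 3] Module.End (ZMod 3) Tens :=
  (LinearMap.mul (ZMod 3) Tens).comp (TensorAlgebra.ι (ZMod 3))

/-- One step of the simultaneous recursion for `(v, a · v, t · v)`: the letter `y` sends
`(v, v₁, v₂)` to `(y ⊗ v, ∂ₓ y ⊗ v, (x y) ⊗ v₁ + (x² y) ⊗ v₂)`. -/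
def recStep : Alphabet →ₗ[ZMod 3] Module.End (ZMod 3) (Tens × Tens × Tens) where
  toFun y :=
    ((consLetter y).comp (LinearMap.fst _ _ _)).prod
      (((consLetter (dx y)).comp (LinearMap.fst _ _ _)).prod
        (((consLetter (x * y)).comp ((LinearMap.fst _ _ _).comp (LinearMap.snd _ _ _))) +
          ((consLetter (x ^ 2 * y)).comp ((LinearMap.snd _ _ _).comp (LinearMap.snd _ _ _)))))
  map_add' y z := by
    ext <;> simp [mul_add]
  map_smul' c y := by
    ext <;> simp

/-- The triple `(v, a · v, t · v)` as a linear function of `v ∈ T(X)`. -/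
def recTriple : Tens →ₗ[ZMod 3] Tens × Tens × Tens :=
  (LinearMap.applyₗ ((1 : Tens), (0 : Tens), (0 : Tens))).comp
    (TensorAlgebra.lift (ZMod 3) recStep).toLinearMap

/-- The operator on `T(X)` by which the generator `a` with `ψ(a) = ∂ₓ` acts.
See `opA_one`, `opA_cons`. -/
def opA : Module.End (ZMod 3) Tens :=
  ((LinearMap.fst _ _ _).comp (LinearMap.snd _ _ _)).comp recTriple

/-- The operator on `T(X)` by which the generator `t` with `ψ(t) = x ⊗ a + x² ⊗ t` acts.
See `opT_one`, `opT_cons`. -/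
def opT : Module.End (ZMod 3) Tens :=
  ((LinearMap.snd _ _ _).comp (LinearMap.snd _ _ _)).comp recTriple

theorem recTriple_cons (y : Alphabet) (v : Tens) :
    recTriple (TensorAlgebra.ι (ZMod 3) y * v) = recStep y (recTriple v) := by
  simp [recTriple]

theorem recTriple_fst (v : Tens) : (recTriple v).1 = v := by
  have key : ∀ u w : Tens, ∀ s : Tens × Tens,
      (TensorAlgebra.lift (ZMod 3) recStep u (w, s)).1 = u * w := by
    intro u
    induction u using TensorAlgebra.induction with
    | algebraMap r => intro w s; simp [Algebra.smul_def, Module.algebraMap_end_apply]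
    | ι y => intro w s; simp [recStep, consLetter]
    | mul u₁ u₂ h₁ h₂ =>
      intro w s
      rw [map_mul, Module.End.mul_apply]
      obtain ⟨w', s', h⟩ : ∃ w' s', TensorAlgebra.lift (ZMod 3) recStep u₂ (w, s) = (w', s') :=
        ⟨_, _, rfl⟩
      have h' := h₂ w s
      rw [h] at h' ⊢
      rw [h₁, mul_assoc, ← h']
    | add u₁ u₂ h₁ h₂ =>
      intro w s
      rw [map_add, LinearMap.add_apply, Prod.fst_add, h₁, h₂, add_mul]
  simpa [recTriple] using key v 1 (0, 0)

/-- The action is zero on `X^{⊗0}`. -/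
theorem opA_one : opA 1 = 0 := by simp [opA, recTriple]

/-- The action is zero on `X^{⊗0}`. -/
theorem opT_one : opT 1 = 0 := by simp [opT, recTriple]

/-- `a · (y ⊗ v) = ∂ₓ y ⊗ v`. -/
theorem opA_cons (y : Alphabet) (v : Tens) :
    opA (TensorAlgebra.ι (ZMod 3) y * v) = TensorAlgebra.ι (ZMod 3) (dx y) * v := by
  simp [opA, recTriple_cons, recStep, consLetter, recTriple_fst]

/-- `t · (y ⊗ v) = x y ⊗ (a · v) + x² y ⊗ (t · v)`. -/
theorem opT_cons (y : Alphabet) (v : Tens) :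
    opT (TensorAlgebra.ι (ZMod 3) y * v) =
      TensorAlgebra.ι (ZMod 3) (x * y) * opA v + TensorAlgebra.ι (ZMod 3) (x ^ 2 * y) * opT v := by
  simp [opT, opA, recTriple_cons, recStep, consLetter]

/-- The Gupta–Sidki Lie algebra: the Lie algebra generated by `a` and `t`, made faithful on
`T(X)`, i.e. the Lie algebra of operators on `T(X)` generated by the actions of `a` and `t`. -/
def gsLie : LieSubalgebra (ZMod 3) (Module.End (ZMod 3) Tens) :=
  LieSubalgebra.lieSpan (ZMod 3) (Module.End (ZMod 3) Tens) {opA, opT}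

end

end GuptaSidki

/-- Lie polynomials in countably many indeterminates: the free Lie algebra on `ℕ`, realised as the
Lie subalgebra generated by the indeterminates inside the free associative algebra. -/
def LiePolynomials (k : Type*) [CommRing k] : LieSubalgebra k (FreeAlgebra k ℕ) :=
  LieSubalgebra.lieSpan k (FreeAlgebra k ℕ) (Set.range (FreeAlgebra.ι k))

/-- A Lie algebra `L` of elements of an associative algebra `A` (with the commutator bracket) is PI
if some non-zero Lie polynomial vanishes under every substitution of elements of `L`. Since brackets
in `L` are commutators in `A`, the value of a Lie polynomial may be computed in `A`. -/
def LieSubalgebra.IsPI {k A : Type*} [CommRing k] [Ring A] [Algebra k A]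
    (L : LieSubalgebra k A) : Prop :=
  ∃ P ∈ LiePolynomials k, P ≠ 0 ∧
    ∀ f : ℕ → A, (∀ i, f i ∈ L) → FreeAlgebra.lift k f P = 0

namespace GuptaSidki

noncomputable section

/-! Everything rests on the self-similarity `z = α ∂ₓ + 1 ⊗ z₀ + x ⊗ z₁ + x² ⊗ z₂`, with `α` scalar
and all `zₚ` again in `L` (`exists_decomposition`).

Closure under cubes: `L` is spanned by `a`, `t` and the ideal `Der` generated by `[a, t]`. This
ideal absorbs tensoring by letters (`Der.tmulOp`) and has an explicit spanning set (`Layer`), on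
which cubes are computed directly; Jacobson's formula in characteristic 3 extends this to sums.

Nillity: a word of length `d` in `a, t` has a coordinate `z₀` of length at most `d / 2`
(`Len.coord`), and if `α = 0` then `z` is nilpotent as soon as `z₀` is. Cubing triples the length
but kills the `∂ₓ`-terms of both `z³` and its coordinate `(z³)₀`. Hence two passages to coordinates
reduce `z` to an element of length at most `3d / 4`, and induction on length applies
(`isNilpotent_of_len`). Nilpotency of `ad z` follows from that of `z`.

Unboundedness and identities: the elements `chain k` of `L` act on suitable tensors as the matrix
units `E_{k,k+1}` (`chain_marked`). Their sums are shifts of arbitrarily large nilpotency index.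
Distributing the matrix units over the indeterminates according to a word `w` isolates the
coefficient of `w` in a polynomial, so not even an associative identity can hold. Non-nilpotency
follows from the unboundedness of the indices of the `ad z`. -/

/-! ### Operators on the tensor algebra defined by recursion on the first letter -/

/-- The algebra of operators on `T(X)`. -/
abbrev Op : Type := Module.End (ZMod 3) Tens

/-- Prepending a letter to a tensor. -/
local notation "ιX" => TensorAlgebra.ι (ZMod 3) (M := Alphabet)

/-- One step of the recursion for the pair `(v, f · v)`. -/
def consStep (f : Alphabet →ₗ[ZMod 3] Op) :
    Alphabet →ₗ[ZMod 3] Module.End (ZMod 3) (Tens × Tens) where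
  toFun y := ((consLetter y).comp (LinearMap.fst _ _ _)).prod ((f y).comp (LinearMap.fst _ _ _))
  map_add' y z := by ext <;> simp
  map_smul' c y := by ext <;> simp

/-- The operator that kills `1` and sends `y ⊗ v` to `f y v`. -/
def consRec (f : Alphabet →ₗ[ZMod 3] Op) : Op :=
  (LinearMap.snd _ _ _).comp ((LinearMap.applyₗ ((1 : Tens), (0 : Tens))).comp
    (TensorAlgebra.lift (ZMod 3) (consStep f)).toLinearMap)

theorem consRec_one (f : Alphabet →ₗ[ZMod 3] Op) : consRec f 1 = 0 := by
  simp [consRec]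

theorem lift_consStep_fst (f : Alphabet →ₗ[ZMod 3] Op) (u : Tens) :
    ∀ p : Tens × Tens, (TensorAlgebra.lift (ZMod 3) (consStep f) u p).1 = u * p.1 := by
  induction u using TensorAlgebra.induction with
  | algebraMap r => intro p; simp [Algebra.smul_def, Module.algebraMap_end_apply]
  | ι y => intro p; simp [consStep, consLetter]
  | mul u₁ u₂ h₁ h₂ => intro p; rw [map_mul, Module.End.mul_apply, h₁, h₂, mul_assoc]
  | add u₁ u₂ h₁ h₂ =>
    intro p
    rw [map_add, LinearMap.add_apply, Prod.fst_add, h₁, h₂, add_mul]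

theorem consRec_cons (f : Alphabet →ₗ[ZMod 3] Op) (y : Alphabet) (v : Tens) :
    consRec f (ιX y * v) = f y v := by
  have h := lift_consStep_fst f v (1, 0)
  rw [mul_one] at h
  change (TensorAlgebra.lift (ZMod 3) (consStep f) (ιX y * v) (1, 0)).2 = f y v
  rw [map_mul, TensorAlgebra.lift_ι_apply, Module.End.mul_apply]
  change f y (TensorAlgebra.lift (ZMod 3) (consStep f) v (1, 0)).1 = f y v
  rw [h]

theorem tens_mem {S : Submodule (ZMod 3) Tens} (h1 : (1 : Tens) ∈ S)
    (hc : ∀ (y : Alphabet) (v : Tens), ιX y * v ∈ S) (v : Tens) : v ∈ S := by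
  have key : ∀ u : Tens, ∀ w ∈ S, u * w ∈ S := by
    intro u
    induction u using TensorAlgebra.induction with
    | algebraMap r => intro w hw; rw [← Algebra.smul_def]; exact S.smul_mem _ hw
    | ι y => intro w _; exact hc y w
    | mul u₁ u₂ h₁ h₂ => intro w hw; rw [mul_assoc]; exact h₁ _ (h₂ _ hw)
    | add u₁ u₂ h₁ h₂ => intro w hw; rw [add_mul]; exact S.add_mem (h₁ _ hw) (h₂ _ hw)
  simpa using key v 1 h1

/-- The basic tool for operator identities: `T(X)` is spanned by `1` and the tensors `y ⊗ v`, so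
only the first letter has to be examined. -/
theorem op_ext {f g : Op} (h1 : f 1 = g 1)
    (hc : ∀ (y : Alphabet) (v : Tens), f (ιX y * v) = g (ιX y * v)) : f = g :=
  LinearMap.ext fun v => tens_mem (S := LinearMap.eqLocus f g) h1 hc v

/-! ### The alphabet -/

theorem x_pow_three : x ^ 3 = 0 := by
  have h : AdjoinRoot.mk (Polynomial.X ^ 3 : (ZMod 3)[X]) (Polynomial.X ^ 3) = 0 :=
    AdjoinRoot.mk_self
  rwa [map_pow] at h

theorem dx_x : dx x = 1 := by
  have h := dx_mk Polynomial.X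
  rwa [Polynomial.derivative_X, map_one] at h

theorem dx_one : dx 1 = 0 := dx.map_one_eq_zero

theorem dx_x_sq : dx (x ^ 2) = 2 * x := by
  rw [Derivation.leibniz_pow, dx_x]; simp [two_mul, two_smul]

/-- The coefficient of `x ^ p`, for `p < 3`. -/
def coef (p : ℕ) : Alphabet →ₗ[ZMod 3] ZMod 3 :=
  (Polynomial.lcoeff (ZMod 3) p).comp
    (AdjoinRoot.modByMonicHom (Polynomial.monic_X_pow (R := ZMod 3) 3))

theorem coef_mk {p : ℕ} (hp : p < 3) (f : (ZMod 3)[X]) :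
    coef p (AdjoinRoot.mk (Polynomial.X ^ 3) f) = f.coeff p := by
  have h := congrArg (fun q => Polynomial.coeff q p)
    (Polynomial.modByMonic_add_div f (Polynomial.X ^ 3 : (ZMod 3)[X]))
  simp only [Polynomial.coeff_add, Polynomial.coeff_X_pow_mul', Nat.not_le.mpr hp, if_false,
    add_zero] at h
  simp [coef, h]

theorem coef_dx {p : ℕ} (hp : p + 1 < 3) (y : Alphabet) :
    coef p (dx y) = coef (p + 1) y * (p + 1) := by
  obtain ⟨f, rfl⟩ := AdjoinRoot.mk_surjective y
  rw [dx_mk, coef_mk (by omega), coef_mk hp, Polynomial.coeff_derivative]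

theorem coef_two_dx (y : Alphabet) : coef 2 (dx y) = 0 := by
  obtain ⟨f, rfl⟩ := AdjoinRoot.mk_surjective y
  rw [dx_mk, coef_mk (by omega), Polynomial.coeff_derivative]
  have h : (((2 : ℕ) : ZMod 3) + 1) = 0 := by decide
  rw [h, mul_zero]

theorem coef_x_pow_mul {p : ℕ} (hp : p < 3) (i : ℕ) (y : Alphabet) :
    coef p (x ^ i * y) = if i ≤ p then coef (p - i) y else 0 := by
  obtain ⟨f, rfl⟩ := AdjoinRoot.mk_surjective y
  have h : x ^ i * AdjoinRoot.mk (Polynomial.X ^ 3 : (ZMod 3)[X]) f =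
      AdjoinRoot.mk _ (Polynomial.X ^ i * f) := by rw [map_mul, map_pow]; rfl
  rw [h, coef_mk hp, Polynomial.coeff_X_pow_mul', coef_mk (by omega)]

theorem coef_x_pow {p : ℕ} (hp : p < 3) (i : ℕ) : coef p (x ^ i) = if p = i then 1 else 0 := by
  have h : x ^ i = AdjoinRoot.mk (Polynomial.X ^ 3 : (ZMod 3)[X]) (Polynomial.X ^ i) := by
    rw [map_pow]; rfl
  rw [h, coef_mk hp, Polynomial.coeff_X_pow]

theorem coef_one {p : ℕ} (hp : p < 3) : coef p 1 = if p = 0 then 1 else 0 := by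
  simpa using coef_x_pow hp 0

theorem coef_x {p : ℕ} (hp : p < 3) : coef p x = if p = 1 then 1 else 0 := by
  simpa using coef_x_pow hp 1

/-! ### The operators `y ⊗ u` -/

/-- The operator `y ⊗ u`, which sends `z ⊗ v` to `y z ⊗ u v` and kills `1`. -/
def tmulOp (y : Alphabet) (u : Op) : Op :=
  consRec
    { toFun := fun z => (consLetter (y * z)).comp u
      map_add' := fun z w => by rw [mul_add, map_add, LinearMap.add_comp]
      map_smul' := fun c z => by
        rw [mul_smul_comm, map_smul, LinearMap.smul_comp, RingHom.id_apply] }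

theorem tmulOp_one (y : Alphabet) (u : Op) : tmulOp y u 1 = 0 := consRec_one _

theorem tmulOp_cons (y : Alphabet) (u : Op) (z : Alphabet) (v : Tens) :
    tmulOp y u (ιX z * v) = ιX (y * z) * u v := by
  rw [tmulOp, consRec_cons]; rfl

theorem tmulOp_add (y : Alphabet) (u w : Op) : tmulOp y (u + w) = tmulOp y u + tmulOp y w :=
  op_ext (by simp [tmulOp_one]) fun z v => by simp [tmulOp_cons, mul_add]

theorem tmulOp_smul (y : Alphabet) (c : ZMod 3) (u : Op) : tmulOp y (c • u) = c • tmulOp y u :=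
  op_ext (by simp [tmulOp_one]) fun z v => by simp [tmulOp_cons]

theorem tmulOp_zero (y : Alphabet) : tmulOp y 0 = 0 :=
  op_ext (by simp [tmulOp_one]) fun z v => by simp [tmulOp_cons]

theorem add_tmulOp (y z : Alphabet) (u : Op) : tmulOp (y + z) u = tmulOp y u + tmulOp z u :=
  op_ext (by simp [tmulOp_one]) fun w v => by simp [tmulOp_cons, add_mul]

theorem zero_tmulOp (u : Op) : tmulOp 0 u = 0 :=
  op_ext (by simp [tmulOp_one]) fun z v => by simp [tmulOp_cons]

theorem two_mul_tmulOp (y : Alphabet) (u : Op) : tmulOp (2 * y) u = (2 : ZMod 3) • tmulOp y u := by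
  rw [two_mul, add_tmulOp, two_smul]

theorem tmulOp_sub (y : Alphabet) (u w : Op) : tmulOp y (u - w) = tmulOp y u - tmulOp y w :=
  op_ext (by simp [tmulOp_one]) fun z v => by simp [tmulOp_cons, mul_sub]

theorem tmulOp_mul (y z : Alphabet) (u w : Op) :
    tmulOp y u * tmulOp z w = tmulOp (y * z) (u * w) :=
  op_ext (by simp [tmulOp_one]) fun s v => by simp [tmulOp_cons, mul_assoc]

theorem tmulOp_lie (y z : Alphabet) (u w : Op) :
    ⁅tmulOp y u, tmulOp z w⁆ = tmulOp (y * z) ⁅u, w⁆ := by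
  rw [LieRing.of_associative_ring_bracket, LieRing.of_associative_ring_bracket, tmulOp_mul,
    tmulOp_mul, mul_comm z y, tmulOp_sub]

theorem opA_lie_tmulOp (y : Alphabet) (u : Op) : ⁅opA, tmulOp y u⁆ = tmulOp (dx y) u := by
  rw [LieRing.of_associative_ring_bracket]
  refine op_ext (by simp [tmulOp_one, opA_one]) fun z v => ?_
  simp [tmulOp_cons, opA_cons, add_mul, mul_comm z]

theorem opT_eq : opT = tmulOp x opA + tmulOp (x ^ 2) opT :=
  op_ext (by simp [tmulOp_one, opT_one]) fun z v => by simp [tmulOp_cons, opT_cons]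

theorem opT_lie_tmulOp (y : Alphabet) (u : Op) :
    ⁅opT, tmulOp y u⁆ = tmulOp (x * y) ⁅opA, u⁆ + tmulOp (x ^ 2 * y) ⁅opT, u⁆ := by
  conv_lhs => rw [opT_eq]
  rw [add_lie, tmulOp_lie, tmulOp_lie]

/-! ### Coordinates -/

/-- The map sending `y ⊗ v` to `yₚ v`, where `yₚ` is the coefficient of `x ^ p` in `y`. -/
def strip (p : ℕ) : Op :=
  consRec ((LinearMap.toSpanSingleton (ZMod 3) Op 1).comp (coef p))

theorem strip_one (p : ℕ) : strip p 1 = 0 := consRec_one _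

theorem strip_cons (p : ℕ) (y : Alphabet) (v : Tens) : strip p (ιX y * v) = coef p y • v := by
  rw [strip, consRec_cons]; simp

/-- This and the next four relations push `strip` to the right past `a` and `t`. An `a` raises the
index `p` and emits no letter; a `t` lowers `p` and emits at most one letter per term. Hence the
halving of length. -/
theorem strip_mul_opA {p : ℕ} (hp : p + 1 < 3) :
    strip p * opA = ((p : ZMod 3) + 1) • strip (p + 1) :=
  op_ext (by simp [strip_one, opA_one]) fun y v => by
    simp [strip_cons, opA_cons, coef_dx hp, mul_comm, smul_smul, -smul_eq_mul]

theorem strip_two_mul_opA : strip 2 * opA = 0 :=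
  op_ext (by simp [opA_one]) fun y v => by simp [strip_cons, opA_cons, coef_two_dx]

theorem strip_zero_mul_opT : strip 0 * opT = 0 :=
  op_ext (by simp [opT_one]) fun y v => by
    have h := coef_x_pow_mul (p := 0) (by omega) 1 y
    rw [pow_one] at h
    simp [strip_cons, opT_cons, coef_x_pow_mul, h]

theorem strip_one_mul_opT : strip 1 * opT = opA * strip 0 :=
  op_ext (by simp [opT_one, strip_one]) fun y v => by
    have h := coef_x_pow_mul (p := 1) (by omega) 1 y
    rw [pow_one] at h
    simp [strip_cons, opT_cons, coef_x_pow_mul, h]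

theorem strip_two_mul_opT : strip 2 * opT = opA * strip 1 + opT * strip 0 :=
  op_ext (by simp [opT_one, strip_one]) fun y v => by
    have h := coef_x_pow_mul (p := 2) (by omega) 1 y
    rw [pow_one] at h
    simp [strip_cons, opT_cons, coef_x_pow_mul, h]

/-- The coordinate `zₚ` of an operator `z`, determined by `z · (1 ⊗ v) = ∑ x ^ p ⊗ zₚ · v`. -/
def coord (p : ℕ) (z : Op) : Op := strip p * z * consLetter 1

theorem coord_add (p : ℕ) (z w : Op) : coord p (z + w) = coord p z + coord p w := by
  simp [coord, mul_add, add_mul]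

theorem coord_smul (p : ℕ) (c : ZMod 3) (z : Op) : coord p (c • z) = c • coord p z := by
  simp [coord]

theorem coord_opA (p : ℕ) : coord p opA = 0 := by
  ext1 v
  simp [coord, consLetter, opA_cons]

theorem coord_tmulOp (p : ℕ) (y : Alphabet) (u : Op) : coord p (tmulOp y u) = coef p y • u := by
  ext1 v
  simp [coord, consLetter, tmulOp_cons, strip_cons]

/-! ### The derived algebra -/

theorem op_lie_smul (c : ZMod 3) (u w : Op) : ⁅u, c • w⁆ = c • ⁅u, w⁆ := by
  simp [LieRing.of_associative_ring_bracket, smul_sub]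

theorem opA_mem : opA ∈ gsLie := LieSubalgebra.subset_lieSpan (by simp)

theorem opT_mem : opT ∈ gsLie := LieSubalgebra.subset_lieSpan (by simp)

theorem gsLie_induction {p : Op → Prop} (hA : p opA) (hT : p opT) (zero : p 0)
    (add : ∀ z ∈ gsLie, ∀ w ∈ gsLie, p z → p w → p (z + w))
    (smul : ∀ (c : ZMod 3), ∀ z ∈ gsLie, p z → p (c • z))
    (lie : ∀ z ∈ gsLie, ∀ w ∈ gsLie, p z → p w → p ⁅z, w⁆) {z : Op} (hz : z ∈ gsLie) : p z := by
  refine LieSubalgebra.lieSpan_induction (R := ZMod 3) (s := {opA, opT}) (p := fun z _ => p z)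
    ?_ zero (fun z w hz hw => add z hz w hw) smul (fun z w hz hw => lie z hz w hw) hz
  rintro z (rfl | rfl)
  · exact hA
  · exact hT

/-- The ideal of the Gupta–Sidki Lie algebra generated by `[a, t]`. -/
inductive Der : Op → Prop
  | base : Der ⁅opA, opT⁆
  | zero : Der 0
  | add {u w : Op} : Der u → Der w → Der (u + w)
  | smul (c : ZMod 3) {u : Op} : Der u → Der (c • u)
  | lieA {u : Op} : Der u → Der ⁅opA, u⁆
  | lieT {u : Op} : Der u → Der ⁅opT, u⁆

theorem Der.neg {u : Op} (hu : Der u) : Der (-u) := by simpa using hu.smul (-1)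

theorem Der.sub {u w : Op} (hu : Der u) (hw : Der w) : Der (u - w) := by
  rw [sub_eq_add_neg]; exact hu.add hw.neg

theorem Der.mem {u : Op} (hu : Der u) : u ∈ gsLie := by
  induction hu with
  | base => exact gsLie.lie_mem opA_mem opT_mem
  | zero => exact gsLie.zero_mem
  | add _ _ h₁ h₂ => exact gsLie.add_mem h₁ h₂
  | smul c _ h => exact gsLie.smul_mem c h
  | lieA _ h => exact gsLie.lie_mem opA_mem h
  | lieT _ h => exact gsLie.lie_mem opT_mem h

/-- Stability under `ad a` and `ad t` suffices: by the Jacobi identity, the elements whose `ad`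
preserves `Der` form a Lie subalgebra. -/
theorem Der.lie {z u : Op} (hz : z ∈ gsLie) (hu : Der u) : Der ⁅z, u⁆ := by
  revert u
  refine gsLie_induction (p := fun z => ∀ {u}, Der u → Der ⁅z, u⁆) Der.lieA Der.lieT ?_ ?_ ?_ ?_ hz
  · intro u _; rw [zero_lie]; exact Der.zero
  · intro z _ w _ h₁ h₂ u hu; rw [add_lie]; exact (h₁ hu).add (h₂ hu)
  · intro c z _ h u hu; rw [smul_lie]; exact (h hu).smul c
  · intro z _ w _ h₁ h₂ u hu; rw [lie_lie]; exact (h₁ (h₂ hu)).sub (h₂ (h₁ hu))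

theorem opA_lie_opT : ⁅opA, opT⁆ = tmulOp 1 opA + (2 : ZMod 3) • tmulOp x opT := by
  conv_lhs => rw [opT_eq]
  rw [lie_add, opA_lie_tmulOp, opA_lie_tmulOp, dx_x, dx_x_sq, two_mul_tmulOp]

theorem opA_lie_opA_lie_opT : ⁅opA, ⁅opA, opT⁆⁆ = (2 : ZMod 3) • tmulOp 1 opT := by
  rw [opA_lie_opT, lie_add, op_lie_smul, opA_lie_tmulOp, opA_lie_tmulOp, dx_x, dx_one, zero_tmulOp,
    zero_add]

theorem four_smul_op (u : Op) : (2 : ZMod 3) • (2 : ZMod 3) • u = u := by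
  rw [smul_smul, show (2 : ZMod 3) * 2 = 1 by decide, one_smul]

theorem opT_lie_opA_lie_opT : ⁅opT, ⁅opA, opT⁆⁆ = tmulOp (x ^ 2) ⁅opA, opT⁆ := by
  conv_lhs => rw [opA_lie_opT]
  have h : x ^ 2 * x = 0 := by rw [← pow_succ]; exact x_pow_three
  rw [lie_add, op_lie_smul, opT_lie_tmulOp, opT_lie_tmulOp, lie_self, lie_self, tmulOp_zero,
    tmulOp_zero, ← lie_skew, zero_add, add_zero, mul_one, ← pow_two, ← neg_one_smul (ZMod 3),
    tmulOp_smul, ← add_smul, show (-1 + 2 : ZMod 3) = 1 by decide, one_smul]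

theorem der_tmulOp_one_opT : Der (tmulOp 1 opT) := by
  rw [← four_smul_op (tmulOp 1 opT), ← opA_lie_opA_lie_opT]
  exact Der.base.lieA.smul 2

/-- Applying `ad a` differentiates the letter, so `x²` yields `2x` and then `1`; the factor `2` is
its own inverse in `𝔽₃`. -/
theorem Der.tmulOp_of_sq {u : Op} (h : Der (tmulOp (x ^ 2) u)) :
    Der (tmulOp 1 u) ∧ Der (tmulOp x u) ∧ Der (tmulOp (x ^ 2) u) := by
  have h1 : Der (tmulOp x u) := by
    have := h.lieA.smul 2
    rwa [opA_lie_tmulOp, dx_x_sq, two_mul_tmulOp, four_smul_op] at this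
  refine ⟨?_, h1, h⟩
  have := h1.lieA
  rwa [opA_lie_tmulOp, dx_x] at this

theorem Der.tmulOp {u : Op} (hu : Der u) :
    Der (tmulOp 1 u) ∧ Der (tmulOp x u) ∧ Der (tmulOp (x ^ 2) u) := by
  induction hu with
  | base =>
    refine Der.tmulOp_of_sq ?_
    rw [← opT_lie_opA_lie_opT]
    exact Der.base.lieT
  | zero => simpa only [tmulOp_zero, and_self] using Der.zero
  | add _ _ h₁ h₂ =>
    simp only [tmulOp_add]
    exact ⟨h₁.1.add h₂.1, h₁.2.1.add h₂.2.1, h₁.2.2.add h₂.2.2⟩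
  | smul c _ h =>
    simp only [tmulOp_smul]
    exact ⟨h.1.smul c, h.2.1.smul c, h.2.2.smul c⟩
  | lieA _ h =>
    refine Der.tmulOp_of_sq ?_
    -- `[t, x ⊗ u] = x² ⊗ [a, u]`, because the other term carries `x³ = 0`.
    have := h.2.1.lieT
    rwa [opT_lie_tmulOp, ← pow_succ, x_pow_three, zero_tmulOp, add_zero, ← pow_two] at this
  | lieT _ h =>
    refine Der.tmulOp_of_sq ?_
    -- Bracketing with `1 ⊗ t` in place of `t` brings `ad t` into the second factor without changing
    -- the letter `x²`.
    have := Der.lie der_tmulOp_one_opT.mem h.2.2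
    rwa [tmulOp_lie, one_mul] at this

theorem exists_der_of_mem {z : Op} (hz : z ∈ gsLie) :
    ∃ (α β : ZMod 3) (u : Op), Der u ∧ z = α • opA + β • opT + u := by
  refine gsLie_induction (p := fun z => ∃ (α β : ZMod 3) (u : Op), Der u ∧
    z = α • opA + β • opT + u) ⟨1, 0, 0, Der.zero, by simp⟩ ⟨0, 1, 0, Der.zero, by simp⟩
    ⟨0, 0, 0, Der.zero, by simp⟩ ?_ ?_ ?_ hz
  · rintro _ - _ - ⟨α, β, u, hu, rfl⟩ ⟨α', β', u', hu', rfl⟩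
    exact ⟨α + α', β + β', u + u', hu.add hu', by module⟩
  · rintro c _ - ⟨α, β, u, hu, rfl⟩
    exact ⟨c * α, c * β, c • u, hu.smul c, by module⟩
  · rintro z hz w hw ⟨α, β, u, hu, hzu⟩ ⟨α', β', u', hu', hwu⟩
    refine ⟨0, 0, ⁅z, w⁆, ?_, by simp⟩
    have hA : Der ⁅opA, w⁆ := by
      rw [hwu, lie_add, lie_add, op_lie_smul, op_lie_smul, lie_self, smul_zero, zero_add]
      exact (Der.base.smul β').add hu'.lieA
    have hT : Der ⁅opT, w⁆ := by
      rw [hwu, lie_add, lie_add, op_lie_smul, op_lie_smul, lie_self, smul_zero, add_zero,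
        ← lie_skew]
      exact (Der.base.neg.smul α').add hu'.lieT
    rw [hzu, add_lie, add_lie, smul_lie, smul_lie, ← lie_skew u w]
    exact ((hA.smul α).add (hT.smul β)).add (hu.lie hw).neg

/-- The recursive description of the derived algebra: it is spanned by the elements
`x ^ i ⊗ ⋯ ⊗ x ^ j ⊗ u` with `u = [a, t]` or `u = 1 ⊗ t`. -/
inductive Layer : Op → Prop
  | base : Layer ⁅opA, opT⁆
  | base' : Layer (tmulOp 1 opT)
  | zero : Layer 0
  | add {u w : Op} : Layer u → Layer w → Layer (u + w)
  | smul (c : ZMod 3) {u : Op} : Layer u → Layer (c • u)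
  | tmul₀ {u : Op} : Layer u → Layer (tmulOp 1 u)
  | tmul₁ {u : Op} : Layer u → Layer (tmulOp x u)
  | tmul₂ {u : Op} : Layer u → Layer (tmulOp (x ^ 2) u)

theorem Layer.der {u : Op} (hu : Layer u) : Der u := by
  induction hu with
  | base => exact Der.base
  | base' => exact der_tmulOp_one_opT
  | zero => exact Der.zero
  | add _ _ h₁ h₂ => exact h₁.add h₂
  | smul c _ h => exact h.smul c
  | tmul₀ _ h => exact h.tmulOp.1
  | tmul₁ _ h => exact h.tmulOp.2.1
  | tmul₂ _ h => exact h.tmulOp.2.2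

theorem Layer.lieA {u : Op} (hu : Layer u) : Layer ⁅opA, u⁆ := by
  induction hu with
  | base => rw [opA_lie_opA_lie_opT]; exact Layer.base'.smul 2
  | base' => rw [opA_lie_tmulOp, dx_one, zero_tmulOp]; exact Layer.zero
  | zero => rw [lie_zero]; exact Layer.zero
  | add _ _ h₁ h₂ => rw [lie_add]; exact h₁.add h₂
  | smul c _ h => rw [op_lie_smul]; exact h.smul c
  | tmul₀ _ _ => rw [opA_lie_tmulOp, dx_one, zero_tmulOp]; exact Layer.zero
  | tmul₁ hu _ => rw [opA_lie_tmulOp, dx_x]; exact hu.tmul₀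
  | tmul₂ hu _ => rw [opA_lie_tmulOp, dx_x_sq, two_mul_tmulOp]; exact hu.tmul₁.smul 2

theorem x_sq_mul_x : x ^ 2 * x = 0 := by rw [← pow_succ, x_pow_three]

theorem x_mul_x_sq : x * x ^ 2 = 0 := by rw [← pow_succ', x_pow_three]

theorem x_sq_mul_x_sq : x ^ 2 * x ^ 2 = 0 := by rw [pow_two x, mul_assoc, ← pow_two,
  x_mul_x_sq, mul_zero]

theorem Layer.lieT {u : Op} (hu : Layer u) : Layer ⁅opT, u⁆ := by
  induction hu with
  | base => rw [opT_lie_opA_lie_opT]; exact Layer.base.tmul₂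
  | base' =>
    rw [opT_lie_tmulOp, lie_self, tmulOp_zero, add_zero, mul_one]; exact Layer.base.tmul₁
  | zero => rw [lie_zero]; exact Layer.zero
  | add _ _ h₁ h₂ => rw [lie_add]; exact h₁.add h₂
  | smul c _ h => rw [op_lie_smul]; exact h.smul c
  | tmul₀ hu h => rw [opT_lie_tmulOp, mul_one, mul_one]; exact hu.lieA.tmul₁.add h.tmul₂
  | tmul₁ hu h =>
    rw [opT_lie_tmulOp, x_sq_mul_x, zero_tmulOp, add_zero, ← pow_two]; exact hu.lieA.tmul₂
  | tmul₂ _ _ =>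
    rw [opT_lie_tmulOp, x_mul_x_sq, x_sq_mul_x_sq, zero_tmulOp, zero_tmulOp, add_zero]
    exact Layer.zero

theorem Der.layer {u : Op} (hu : Der u) : Layer u := by
  induction hu with
  | base => exact Layer.base
  | zero => exact Layer.zero
  | add _ _ h₁ h₂ => exact h₁.add h₂
  | smul c _ h => exact h.smul c
  | lieA _ h => exact h.lieA
  | lieT _ h => exact h.lieT

/-! ### Closure under cubes -/

/-- Jacobson's formula for `p = 3`: over `ℤ` the two sides differ by `3 (u w u + w u w)`. -/
theorem add_cube (u w : Op) : (u + w) ^ 3 = u ^ 3 + w ^ 3 + ⁅u, ⁅u, w⁆⁆ + ⁅w, ⁅w, u⁆⁆ := by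
  have h : (u + w) ^ 3 = u ^ 3 + w ^ 3 + ⁅u, ⁅u, w⁆⁆ + ⁅w, ⁅w, u⁆⁆ +
      (3 : ℕ) • (u * w * u + w * u * w) := by
    simp only [LieRing.of_associative_ring_bracket]
    noncomm_ring
  rw [h, ← Nat.cast_smul_eq_nsmul (ZMod 3), show ((3 : ℕ) : ZMod 3) = 0 by decide, zero_smul,
    add_zero]

theorem tmulOp_cube (y : Alphabet) (u : Op) : tmulOp y u ^ 3 = tmulOp (y ^ 3) (u ^ 3) := by
  rw [pow_three (tmulOp y u), pow_three y, pow_three u, tmulOp_mul, tmulOp_mul]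

theorem dx_dx_dx (y : Alphabet) : dx (dx (dx y)) = 0 := by
  obtain ⟨f, rfl⟩ := AdjoinRoot.mk_surjective y
  rw [dx_mk, dx_mk, dx_mk]
  convert map_zero (AdjoinRoot.mk (Polynomial.X ^ 3 : (ZMod 3)[X]))
  ext n
  simp only [Polynomial.coeff_derivative, Polynomial.coeff_zero]
  push_cast
  generalize (n : ZMod 3) = m
  generalize f.coeff _ = r
  -- Three consecutive elements of `𝔽₃` have product zero.
  revert m r
  decide

theorem opA_cube : opA ^ 3 = 0 :=
  op_ext (by simp [pow_three, opA_one]) fun y v => by simp [pow_three, opA_cons, dx_dx_dx]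

theorem x_sq_cube : (x ^ 2) ^ 3 = 0 := by rw [← pow_mul, mul_comm, pow_mul, x_pow_three]; simp

theorem opT_cube : opT ^ 3 = 0 := by
  conv_lhs => rw [opT_eq]
  rw [add_cube, tmulOp_cube, tmulOp_cube, x_pow_three, x_sq_cube, tmulOp_lie, tmulOp_lie,
    tmulOp_lie, tmulOp_lie, x_mul_x_sq, x_sq_mul_x]
  simp [zero_tmulOp]

theorem opA_lie_opT_cube : Der (⁅opA, opT⁆ ^ 3) := by
  rw [opA_lie_opT, ← tmulOp_smul, add_cube, tmulOp_cube, tmulOp_cube, x_pow_three, opA_cube,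
    tmulOp_zero, zero_tmulOp, zero_add, zero_add, tmulOp_lie, tmulOp_lie, tmulOp_lie, tmulOp_lie,
    one_mul, one_mul, mul_one, ← pow_two]
  simp only [op_lie_smul, smul_lie]
  rw [← lie_skew opT opA]
  exact (Der.base.lieA.smul 2).tmulOp.2.1.add (((Der.base.neg.lieT.smul 2).smul 2).tmulOp.2.2)

/-- Cubes are taken factorwise, `(y ⊗ u)³ = y³ ⊗ u³`, and among the letters `1, x, x²` only `1` has
a non-zero cube. -/
theorem Layer.cube {u : Op} (hu : Layer u) : Der (u ^ 3) := by
  induction hu with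
  | base => exact opA_lie_opT_cube
  | base' => rw [tmulOp_cube, opT_cube, tmulOp_zero]; exact Der.zero
  | zero => rw [zero_pow three_ne_zero]; exact Der.zero
  | add hu hw h₁ h₂ =>
    rw [add_cube]
    exact ((h₁.add h₂).add ((hw.der.lie hu.der.mem).lie hu.der.mem)).add
      ((hu.der.lie hw.der.mem).lie hw.der.mem)
  | smul c _ h => rw [smul_pow]; exact h.smul _
  | tmul₀ _ h => rw [tmulOp_cube, one_pow]; exact h.tmulOp.1
  | tmul₁ _ _ => rw [tmulOp_cube, x_pow_three, zero_tmulOp]; exact Der.zero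
  | tmul₂ _ _ => rw [tmulOp_cube, x_sq_cube, zero_tmulOp]; exact Der.zero

theorem add_cube_mem {z w : Op} (hz : z ∈ gsLie) (hw : w ∈ gsLie) (hz3 : z ^ 3 ∈ gsLie)
    (hw3 : w ^ 3 ∈ gsLie) : (z + w) ^ 3 ∈ gsLie := by
  rw [add_cube]
  exact gsLie.add_mem (gsLie.add_mem (gsLie.add_mem hz3 hw3)
    (gsLie.lie_mem hz (gsLie.lie_mem hz hw))) (gsLie.lie_mem hw (gsLie.lie_mem hw hz))

theorem cube_mem {z : Op} (hz : z ∈ gsLie) : z ^ 3 ∈ gsLie := by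
  obtain ⟨α, β, u, hu, rfl⟩ := exists_der_of_mem hz
  have hA := gsLie.smul_mem α opA_mem
  have hT := gsLie.smul_mem β opT_mem
  refine add_cube_mem (gsLie.add_mem hA hT) hu.mem (add_cube_mem hA hT ?_ ?_) hu.layer.cube.mem
  · rw [smul_pow, opA_cube, smul_zero]; exact gsLie.zero_mem
  · rw [smul_pow, opT_cube, smul_zero]; exact gsLie.zero_mem

/-! ### The length filtration of the associative envelope -/

/-- `Len d z` says that `z` is a combination of words of length at most `d` in `a` and `t`. -/
inductive Len : ℕ → Op → Prop
  | one : Len 0 1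
  | zero (d : ℕ) : Len d 0
  | mulA {d : ℕ} {z : Op} : Len d z → Len (d + 1) (opA * z)
  | mulT {d : ℕ} {z : Op} : Len d z → Len (d + 1) (opT * z)
  | add {d : ℕ} {z w : Op} : Len d z → Len d w → Len d (z + w)
  | smul {d : ℕ} (c : ZMod 3) {z : Op} : Len d z → Len d (c • z)
  | succ {d : ℕ} {z : Op} : Len d z → Len (d + 1) z

theorem Len.mono {d e : ℕ} {z : Op} (hz : Len d z) (h : d ≤ e) : Len e z := by
  induction h with
  | refl => exact hz
  | step _ h => exact h.succ

theorem Len.mul {d e : ℕ} {z w : Op} (hz : Len d z) (hw : Len e w) : Len (d + e) (z * w) := by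
  induction hz with
  | one => simpa using hw
  | zero d => rw [zero_mul]; exact Len.zero _
  | mulA _ h => rw [mul_assoc, add_right_comm]; exact h.mulA
  | mulT _ h => rw [mul_assoc, add_right_comm]; exact h.mulT
  | add _ _ h₁ h₂ => rw [add_mul]; exact h₁.add h₂
  | smul c _ h => rw [smul_mul_assoc]; exact h.smul c
  | succ _ h => rw [add_right_comm]; exact h.succ

theorem exists_len {z : Op} (hz : z ∈ gsLie) : ∃ d, Len d z := by
  refine gsLie_induction (p := fun z => ∃ d, Len d z) ⟨1, by simpa using Len.one.mulA⟩
    ⟨1, by simpa using Len.one.mulT⟩ ⟨0, Len.zero 0⟩ ?_ ?_ ?_ hz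
  · rintro z - w - ⟨d, hd⟩ ⟨e, he⟩
    exact ⟨max d e, (hd.mono (le_max_left _ _)).add (he.mono (le_max_right _ _))⟩
  · rintro c z - ⟨d, hd⟩
    exact ⟨d, hd.smul c⟩
  · rintro z - w - ⟨d, hd⟩ ⟨e, he⟩
    refine ⟨d + e, ?_⟩
    rw [LieRing.of_associative_ring_bracket, sub_eq_add_neg, ← neg_one_smul (ZMod 3)]
    exact (hd.mul he).add (((he.mul hd).mono (add_comm e d).le).smul _)

theorem Len.eq_smul_one {d : ℕ} {z : Op} (hz : Len d z) (hd : d = 0) :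
    ∃ c : ZMod 3, z = c • (1 : Op) := by
  induction hz with
  | one => exact ⟨1, by simp⟩
  | zero d => exact ⟨0, by simp⟩
  | mulA _ _ => omega
  | mulT _ _ => omega
  | add _ _ h₁ h₂ =>
    obtain ⟨c, rfl⟩ := h₁ hd
    obtain ⟨c', rfl⟩ := h₂ hd
    exact ⟨c + c', by module⟩
  | smul c _ h =>
    obtain ⟨c', rfl⟩ := h hd
    exact ⟨c * c', by module⟩
  | succ _ _ => omega

/-- Passing to coordinates halves the length. -/
theorem Len.coord {d : ℕ} {z : Op} (hz : Len d z) :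
    Len (d / 2) (coord 0 z) ∧ Len ((d + 1) / 2) (coord 1 z) ∧ Len ((d + 2) / 2) (coord 2 z) := by
  induction hz with
  | one =>
    have h : ∀ p < 3, GuptaSidki.coord p 1 =
        (if p = 0 then (1 : ZMod 3) else 0) • (1 : Op) := by
      intro p hp
      ext1 v
      simp only [GuptaSidki.coord, consLetter, mul_one, Module.End.mul_apply, LinearMap.comp_apply,
        LinearMap.mul_apply', strip_cons, coef_one hp, LinearMap.smul_apply, Module.End.one_apply]
    refine ⟨?_, ?_, ?_⟩
    · rw [h 0 (by omega)]; exact Len.one.smul _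
    · rw [h 1 (by omega)]; exact (Len.one.smul _).mono (by omega)
    · rw [h 2 (by omega)]; exact (Len.one.smul _).mono (by omega)
  | zero d =>
    simp only [GuptaSidki.coord, mul_zero, zero_mul]
    exact ⟨Len.zero _, Len.zero _, Len.zero _⟩
  | mulA _ h =>
    simp only [GuptaSidki.coord, ← mul_assoc] at h ⊢
    rw [strip_mul_opA (by omega), strip_mul_opA (by omega), strip_two_mul_opA]
    simp only [smul_mul_assoc, zero_mul]
    exact ⟨h.2.1.smul _, h.2.2.smul _, Len.zero _⟩
  | @mulT d z _ h =>
    simp only [GuptaSidki.coord, ← mul_assoc] at h ⊢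
    rw [strip_zero_mul_opT, strip_one_mul_opT, strip_two_mul_opT]
    simp only [zero_mul, add_mul, mul_assoc] at h ⊢
    exact ⟨Len.zero _, h.1.mulA.mono (by omega), (h.2.1.mulA.mono (by omega)).add
      (h.1.mulT.mono (by omega))⟩
  | add _ _ h₁ h₂ =>
    simp only [coord_add]
    exact ⟨h₁.1.add h₂.1, h₁.2.1.add h₂.2.1, h₁.2.2.add h₂.2.2⟩
  | smul c _ h =>
    simp only [coord_smul]
    exact ⟨h.1.smul c, h.2.1.smul c, h.2.2.smul c⟩
  | succ _ h =>
    exact ⟨h.1.mono (by omega), h.2.1.mono (by omega), h.2.2.mono (by omega)⟩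

/-! ### Nillity -/

/-- The tensor `1`, of degree one. -/
def letterOne : Tens := ιX 1 * 1

theorem letterOne_ne_zero : letterOne ≠ 0 := by
  intro h
  have := congrArg (strip 0) h
  simp [letterOne, -mul_one, strip_cons, coef_one] at this

/-- On `X^{⊗1}` the generator `t` is zero and `a` is `∂ₓ`, so `L` acts there by multiples of `∂ₓ`.
The value at the letter `x` thus detects the `∂ₓ`-coefficient. -/
theorem low_values {z : Op} (hz : z ∈ gsLie) :
    z 1 = 0 ∧ z letterOne = 0 ∧ ∃ c : ZMod 3, z (ιX x * 1) = c • letterOne := by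
  refine gsLie_induction (p := fun z => z 1 = 0 ∧ z letterOne = 0 ∧
    ∃ c : ZMod 3, z (ιX x * 1) = c • letterOne) ?_ ?_ ?_ ?_ ?_ ?_ hz
  · refine ⟨opA_one, ?_, 1, ?_⟩
    · rw [letterOne, opA_cons, dx_one, map_zero, zero_mul]
    · rw [opA_cons, dx_x, one_smul, letterOne]
  · refine ⟨opT_one, ?_, 0, ?_⟩
    · rw [letterOne, opT_cons, opA_one, opT_one]; simp
    · rw [opT_cons, opA_one, opT_one]; simp
  · exact ⟨rfl, rfl, 0, by simp⟩
  · rintro z - w - ⟨h₁, h₂, c, h₃⟩ ⟨k₁, k₂, d, k₃⟩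
    refine ⟨?_, ?_, c + d, ?_⟩
    · rw [LinearMap.add_apply, h₁, k₁, add_zero]
    · rw [LinearMap.add_apply, h₂, k₂, add_zero]
    · rw [LinearMap.add_apply, h₃, k₃, add_smul]
  · rintro b z - ⟨h₁, h₂, c, h₃⟩
    refine ⟨?_, ?_, b * c, ?_⟩
    · rw [LinearMap.smul_apply, h₁, smul_zero]
    · rw [LinearMap.smul_apply, h₂, smul_zero]
    · rw [LinearMap.smul_apply, h₃, mul_smul]
  · rintro z - w - ⟨h₁, h₂, c, h₃⟩ ⟨k₁, k₂, d, k₃⟩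
    rw [LieRing.of_associative_ring_bracket]
    refine ⟨by simp [h₁, k₁], by simp [h₂, k₂], 0, ?_⟩
    simp [h₂, k₂, -mul_one, h₃, k₃]

theorem lie_apply_x {z w : Op} (hz : z ∈ gsLie) (hw : w ∈ gsLie) : ⁅z, w⁆ (ιX x * 1) = 0 := by
  obtain ⟨-, h₂, c, h₃⟩ := low_values hz
  obtain ⟨-, k₂, d, k₃⟩ := low_values hw
  rw [LieRing.of_associative_ring_bracket, LinearMap.sub_apply, Module.End.mul_apply,
    Module.End.mul_apply, h₃, k₃, map_smul, map_smul, h₂, k₂, smul_zero, smul_zero, sub_zero]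

/-- The self-similarity structure: `z = α ∂ₓ + 1 ⊗ z₀ + x ⊗ z₁ + x² ⊗ z₂`. -/
theorem exists_decomposition {z : Op} (hz : z ∈ gsLie) :
    ∃ (α : ZMod 3) (z₀ z₁ z₂ : Op), z₀ ∈ gsLie ∧ z₁ ∈ gsLie ∧ z₂ ∈ gsLie ∧
      z₂ (ιX x * 1) = 0 ∧
      z = α • opA + tmulOp 1 z₀ + tmulOp x z₁ + tmulOp (x ^ 2) z₂ := by
  refine gsLie_induction (p := fun z => ∃ (α : ZMod 3) (z₀ z₁ z₂ : Op),
    z₀ ∈ gsLie ∧ z₁ ∈ gsLie ∧ z₂ ∈ gsLie ∧ z₂ (ιX x * 1) = 0 ∧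
      z = α • opA + tmulOp 1 z₀ + tmulOp x z₁ + tmulOp (x ^ 2) z₂) ?_ ?_ ?_ ?_ ?_ ?_ hz
  · exact ⟨1, 0, 0, 0, gsLie.zero_mem, gsLie.zero_mem, gsLie.zero_mem, rfl, by
      simp [tmulOp_zero]⟩
  · refine ⟨0, 0, opA, opT, gsLie.zero_mem, opA_mem, opT_mem, ?_, ?_⟩
    · rw [opT_cons, opA_one, opT_one]; simp
    · conv_lhs => rw [opT_eq]
      simp [tmulOp_zero]
  · exact ⟨0, 0, 0, 0, gsLie.zero_mem, gsLie.zero_mem, gsLie.zero_mem, rfl, by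
      simp [tmulOp_zero]⟩
  · rintro _ - _ - ⟨α, z₀, z₁, z₂, h₀, h₁, h₂, h₃, rfl⟩ ⟨β, w₀, w₁, w₂, k₀, k₁, k₂, k₃, rfl⟩
    refine ⟨α + β, z₀ + w₀, z₁ + w₁, z₂ + w₂, gsLie.add_mem h₀ k₀, gsLie.add_mem h₁ k₁,
      gsLie.add_mem h₂ k₂, by rw [LinearMap.add_apply, h₃, k₃, add_zero], ?_⟩
    simp only [tmulOp_add]
    module
  · rintro c _ - ⟨α, z₀, z₁, z₂, h₀, h₁, h₂, h₃, rfl⟩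
    refine ⟨c * α, c • z₀, c • z₁, c • z₂, gsLie.smul_mem c h₀, gsLie.smul_mem c h₁,
      gsLie.smul_mem c h₂, by rw [LinearMap.smul_apply, h₃, smul_zero], ?_⟩
    simp only [tmulOp_smul]
    module
  · rintro _ - _ - ⟨α, z₀, z₁, z₂, h₀, h₁, h₂, h₃, rfl⟩ ⟨β, w₀, w₁, w₂, k₀, k₁, k₂, k₃, rfl⟩
    refine ⟨0, α • w₁ - β • z₁ + ⁅z₀, w₀⁆,
      (2 * α) • w₂ - (2 * β) • z₂ + ⁅z₀, w₁⁆ + ⁅z₁, w₀⁆,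
      ⁅z₀, w₂⁆ + ⁅z₁, w₁⁆ + ⁅z₂, w₀⁆,
      gsLie.add_mem (gsLie.sub_mem (gsLie.smul_mem _ k₁) (gsLie.smul_mem _ h₁))
        (gsLie.lie_mem h₀ k₀),
      gsLie.add_mem (gsLie.add_mem (gsLie.sub_mem (gsLie.smul_mem _ k₂) (gsLie.smul_mem _ h₂))
        (gsLie.lie_mem h₀ k₁)) (gsLie.lie_mem h₁ k₀),
      gsLie.add_mem (gsLie.add_mem (gsLie.lie_mem h₀ k₂) (gsLie.lie_mem h₁ k₁))
        (gsLie.lie_mem h₂ k₀), ?_, ?_⟩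
    -- The `x²`-coordinate of a bracket is a sum of commutators, since no derivative contributes to
    -- `x²`; commutators vanish at the letter `x`.
    · rw [LinearMap.add_apply, LinearMap.add_apply, lie_apply_x h₀ k₂, lie_apply_x h₁ k₁,
        lie_apply_x h₂ k₀, add_zero, add_zero]
    · have hA : ∀ y u, ⁅tmulOp y u, opA⁆ = - tmulOp (dx y) u := fun y u => by
        rw [← lie_skew, opA_lie_tmulOp]
      simp only [lie_add, add_lie, op_lie_smul, smul_lie, lie_self, opA_lie_tmulOp, hA, tmulOp_lie,
        dx_one, dx_x, dx_x_sq, two_mul_tmulOp, x_mul_x_sq, x_sq_mul_x, x_sq_mul_x_sq, zero_tmulOp,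
        one_mul, mul_one, ← pow_two x, tmulOp_add, tmulOp_sub, tmulOp_smul]
      module

theorem coord_zero_decomposition (α : ZMod 3) (z₀ z₁ z₂ : Op) :
    coord 0 (α • opA + tmulOp 1 z₀ + tmulOp x z₁ + tmulOp (x ^ 2) z₂) = z₀ := by
  simp [coord_add, coord_smul, coord_opA, coord_tmulOp, coef_one, coef_x, coef_x_pow]

theorem isNilpotent_of_decomposition {z₀ z₁ z₂ : Op} (h : IsNilpotent z₀) :
    IsNilpotent (tmulOp 1 z₀ + tmulOp x z₁ + tmulOp (x ^ 2) z₂) := by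
  set z := tmulOp 1 z₀ + tmulOp x z₁ + tmulOp (x ^ 2) z₂ with hz
  -- Exponents start at 1: the identity is not of this form, as every `y ⊗ u` kills the tensor `1`.
  -- Modulo terms in `x` and `x²`, powers are computed on `z₀`; those remaining terms have cube
  -- zero.
  have key : ∀ m, ∃ p q, z ^ (m + 1) = tmulOp 1 (z₀ ^ (m + 1)) + tmulOp x p + tmulOp (x ^ 2) q := by
    intro m
    induction m with
    | zero => exact ⟨z₁, z₂, by simp [hz]⟩
    | succ m ih =>
      obtain ⟨p, q, h⟩ := ih
      refine ⟨z₀ ^ (m + 1) * z₁ + p * z₀, z₀ ^ (m + 1) * z₂ + p * z₁ + q * z₀, ?_⟩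
      rw [pow_succ, h, hz, pow_succ z₀ (m + 1)]
      simp only [mul_add, add_mul, tmulOp_mul, one_mul, mul_one, ← pow_two x, x_mul_x_sq,
        x_sq_mul_x,
        x_sq_mul_x_sq, zero_tmulOp, tmulOp_add]
      abel
  obtain ⟨m, hm⟩ := h
  obtain ⟨p, q, h⟩ := key m
  refine ⟨(m + 1) * 3, ?_⟩
  rw [pow_mul, h, pow_succ z₀, hm, zero_mul, tmulOp_zero, zero_add, pow_three (_ + _)]
  simp only [mul_add, add_mul, tmulOp_mul, ← pow_two x, x_mul_x_sq, x_sq_mul_x, x_sq_mul_x_sq,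
    zero_tmulOp, add_zero]

theorem exists_coord_zero {z : Op} (hz : z ∈ gsLie) (h : z (ιX x * 1) = 0) :
    coord 0 z ∈ gsLie ∧ (IsNilpotent (coord 0 z) → IsNilpotent z) := by
  obtain ⟨α, z₀, z₁, z₂, h₀, h₁, h₂, -, rfl⟩ := exists_decomposition hz
  rw [coord_zero_decomposition]
  refine ⟨h₀, fun hn => ?_⟩
  simp only [LinearMap.add_apply, LinearMap.smul_apply, tmulOp_cons, opA_cons, dx_x,
    (low_values h₀).1, (low_values h₁).1, (low_values h₂).1, mul_zero, add_zero] at h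
  have hα : α = 0 := (smul_eq_zero.mp h).resolve_right letterOne_ne_zero
  rw [hα, zero_smul, zero_add]
  exact isNilpotent_of_decomposition hn

theorem cube_apply_x {z : Op} (hz : z ∈ gsLie) : (z ^ 3) (ιX x * 1) = 0 := by
  obtain ⟨-, h₂, c, h₃⟩ := low_values hz
  rw [pow_three z, Module.End.mul_apply, Module.End.mul_apply, h₃, map_smul, h₂, smul_zero,
    map_zero]

/-- A computation on `1 ⊗ x`. Since `z₂` kills the letter `x`, one application of `z` lands in the
span of `1 ⊗ 1` and `x ⊗ 1`, and two more kill that span. An `x² ⊗ 1` term could survive. -/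
theorem coord_zero_cube_apply_x {z : Op} (hz : z ∈ gsLie) : coord 0 (z ^ 3) (ιX x * 1) = 0 := by
  obtain ⟨α, z₀, z₁, z₂, h₀, h₁, h₂, h₃, rfl⟩ := exists_decomposition hz
  obtain ⟨-, k₀, c₀, l₀⟩ := low_values h₀
  obtain ⟨-, k₁, c₁, l₁⟩ := low_values h₁
  obtain ⟨-, k₂, -⟩ := low_values h₂
  set z := α • opA + tmulOp 1 z₀ + tmulOp x z₁ + tmulOp (x ^ 2) z₂ with hz
  have hz_cons : ∀ y v, z (ιX y * v) = α • (ιX (dx y) * v) + ιX y * z₀ v + ιX (x * y) * z₁ v +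
      ιX (x ^ 2 * y) * z₂ v := fun y v => by
    simp only [hz, LinearMap.add_apply, LinearMap.smul_apply, tmulOp_cons, opA_cons, one_mul]
  have e1 : z (ιX 1 * letterOne) = 0 := by
    rw [hz_cons, k₀, k₁, k₂, dx_one]; simp
  have ex : z (ιX x * letterOne) = α • (ιX 1 * letterOne) := by
    rw [hz_cons, k₀, k₁, k₂, dx_x]; simp
  have e : z (ιX 1 * (ιX x * 1)) = c₀ • (ιX 1 * letterOne) + c₁ • (ιX x * letterOne) := by
    rw [hz_cons, l₀, l₁, h₃, dx_one, mul_one x]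
    simp only [map_zero, zero_mul, smul_zero, zero_add, mul_zero, add_zero, mul_smul_comm]
  have h : (z ^ 3) (ιX 1 * (ιX x * 1)) = 0 := by
    rw [pow_three z, Module.End.mul_apply, Module.End.mul_apply, e, map_add, map_smul, map_smul, e1,
      ex, smul_zero, zero_add, map_smul, map_smul, e1, smul_zero, smul_zero]
  change strip 0 ((z ^ 3) (ιX 1 * (ιX x * 1))) = 0
  rw [h, map_zero]

theorem isNilpotent_of_len (d : ℕ) : ∀ z ∈ gsLie, Len d z → IsNilpotent z := by
  induction d using Nat.strong_induction_on with
  | _ d ih =>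
    intro z hz hd
    rcases Nat.eq_zero_or_pos d with h0 | hpos
    · obtain ⟨c, rfl⟩ := hd.eq_smul_one h0
      -- A scalar operator lying in `L` is zero, because `L` kills the tensor `1`.
      have h1 := (low_values hz).1
      rw [LinearMap.smul_apply, Module.End.one_apply] at h1
      have hc : c = 0 := (smul_eq_zero.mp h1).resolve_right one_ne_zero
      rw [hc, zero_smul]
      exact IsNilpotent.zero
    · have hd3 : Len (d + (d + d)) (z ^ 3) := by rw [pow_three]; exact hd.mul (hd.mul hd)
      obtain ⟨h₁, n₁⟩ := exists_coord_zero (cube_mem hz) (cube_apply_x hz)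
      obtain ⟨h₂, n₂⟩ := exists_coord_zero h₁ (coord_zero_cube_apply_x hz)
      -- Two coordinate passages turn the length bound `3d` into `⌊3d / 4⌋`, which is less than `d`
      -- as `d > 0`.
      have := n₁ (n₂ (ih _ (by omega) _ h₂ hd3.coord.1.coord.1))
      exact this.of_pow

theorem isNilpotent_of_mem {z : Op} (hz : z ∈ gsLie) : IsNilpotent z :=
  let ⟨d, hd⟩ := exists_len hz
  isNilpotent_of_len d z hz hd

/-! ### Elements acting as matrix units -/

/-- The elements `(1 ⊗ 1) ⊗ ⋯ ⊗ (1 ⊗ 1) ⊗ (1 ⊗ x) ⊗ [a, t]`. -/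
def chain : ℕ → Op
  | 0 => tmulOp 1 (tmulOp x ⁅opA, opT⁆)
  | k + 1 => tmulOp 1 (tmulOp 1 (chain k))

/-- The tensor `(x² ⊗ 1) ⊗ ⋯ ⊗ (x² ⊗ 1)` with `n` blocks. -/
def idle : ℕ → Tens
  | 0 => 1
  | n + 1 => ιX (x ^ 2) * (ιX 1 * idle n)

/-- The tensor with `n + 1` blocks `x² ⊗ 1`, except that the block with index `j ≤ n` is
`x² ⊗ x`. -/
def marked : ℕ → ℕ → Tens
  | n, 0 => ιX (x ^ 2) * (ιX x * idle n)
  -- Zero for a block out of range, so that the vanishing lemmas for `j + 1` need no bound on `j`.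
  | 0, _ + 1 => 0
  | n + 1, j + 1 => ιX (x ^ 2) * (ιX 1 * marked n j)

theorem marked_succ_succ (n j : ℕ) :
    marked (n + 1) (j + 1) = ιX (x ^ 2) * (ιX 1 * marked n j) := rfl

theorem chain_mem (k : ℕ) : chain k ∈ gsLie := by
  have h : ∀ k, Der (chain k) := by
    intro k
    induction k with
    | zero => exact Der.base.tmulOp.2.1.tmulOp.1
    | succ k ih => exact ih.tmulOp.1.tmulOp.1
  exact (h k).mem

theorem opA_lie_opT_one : ⁅opA, opT⁆ 1 = 0 := (low_values Der.base.mem).1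

theorem opA_lie_opT_cons (v : Tens) : ⁅opA, opT⁆ (ιX (x ^ 2) * v) = ιX (x ^ 2) * opA v := by
  rw [opA_lie_opT, LinearMap.add_apply, LinearMap.smul_apply, tmulOp_cons, tmulOp_cons, x_mul_x_sq,
    one_mul, map_zero, zero_mul, smul_zero, add_zero]

theorem opA_one_cons (v : Tens) : opA (ιX 1 * v) = 0 := by
  rw [opA_cons, dx_one, map_zero, zero_mul]

theorem opA_lie_opT_idle (n : ℕ) : ⁅opA, opT⁆ (idle n) = 0 := by
  cases n with
  | zero => exact opA_lie_opT_one
  | succ n => rw [idle, opA_lie_opT_cons, opA_one_cons, mul_zero]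

theorem opA_lie_opT_marked_zero (n : ℕ) : ⁅opA, opT⁆ (marked n 0) = idle (n + 1) := by
  rw [marked, opA_lie_opT_cons, opA_cons, dx_x, idle]

theorem opA_lie_opT_marked_succ (n j : ℕ) : ⁅opA, opT⁆ (marked n (j + 1)) = 0 := by
  cases n with
  | zero => rw [marked, map_zero]
  | succ n => rw [marked, opA_lie_opT_cons, opA_one_cons, mul_zero]

theorem chain_idle (k n : ℕ) : chain k (idle n) = 0 := by
  induction k generalizing n with
  | zero =>
    cases n with
    | zero => exact tmulOp_one _ _
    | succ n => rw [chain, idle, tmulOp_cons, tmulOp_cons, opA_lie_opT_idle, mul_zero, mul_zero]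
  | succ k ih =>
    cases n with
    | zero => exact tmulOp_one _ _
    | succ n => rw [chain, idle, tmulOp_cons, tmulOp_cons, ih, mul_zero, mul_zero]

/-- On a tensor beginning with `x²`, `[a, t]` is `a` applied after that letter, since `x · x² = 0`.
It removes the mark `x` of block `k + 1`, or gives zero if there is none, while the factor `1 ⊗ x`
places a mark on block `k`. -/
theorem chain_marked (k : ℕ) {n j : ℕ} (hj : j ≤ n) :
    chain k (marked n j) = if j = k + 1 then marked n k else 0 := by
  induction k generalizing n j with
  | zero =>
    rcases j with _ | j
    · rw [chain, marked, tmulOp_cons, tmulOp_cons, opA_lie_opT_idle, mul_zero, mul_zero,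
        if_neg (by omega)]
    · obtain ⟨n, rfl⟩ : ∃ m, n = m + 1 := ⟨n - 1, by omega⟩
      rw [chain, marked_succ_succ, tmulOp_cons, tmulOp_cons]
      rcases j with _ | j
      · rw [opA_lie_opT_marked_zero, one_mul, mul_one x, if_pos rfl, marked]
      · rw [opA_lie_opT_marked_succ, mul_zero, mul_zero, if_neg (by omega)]
  | succ k ih =>
    rcases j with _ | j
    · rw [chain, marked, tmulOp_cons, tmulOp_cons, chain_idle, mul_zero, mul_zero,
        if_neg (by omega)]
    · obtain ⟨n, rfl⟩ : ∃ m, n = m + 1 := ⟨n - 1, by omega⟩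
      rw [chain, marked, tmulOp_cons, tmulOp_cons, ih (by omega), one_mul, one_mul]
      by_cases h : j = k + 1
      · rw [if_pos h, if_pos (by omega), marked]
      · rw [if_neg h, if_neg (by omega), mul_zero, mul_zero]

theorem strip_marked_zero (n : ℕ) : strip 1 (strip 2 (marked n 0)) = idle n := by
  rw [marked, strip_cons, coef_x_pow (by omega), if_pos rfl, one_smul, strip_cons,
    coef_x (by omega), if_pos rfl, one_smul]

theorem strip_marked_succ (n j : ℕ) : strip 1 (strip 2 (marked n (j + 1))) = 0 := by
  cases n with
  | zero => rw [marked, map_zero, map_zero]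
  | succ n =>
    rw [marked, strip_cons, map_smul, strip_cons, coef_one (by omega), if_neg one_ne_zero,
      zero_smul, smul_zero]

theorem idle_ne_zero (n : ℕ) : idle n ≠ 0 := by
  induction n with
  | zero => exact one_ne_zero
  | succ n ih =>
    intro h
    apply ih
    have := congrArg (fun v => strip 0 (strip 2 v)) h
    simpa only [idle, strip_cons, coef_x_pow (show 2 < 3 by omega), coef_one (show 0 < 3 by omega),
      if_true, one_smul, map_zero] using this

theorem marked_zero_ne_zero (n : ℕ) : marked n 0 ≠ 0 := fun h =>
  idle_ne_zero n (by rw [← strip_marked_zero, h, map_zero, map_zero])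

/-! ### Polynomial identities -/

/-- The substitution that sends the `i`-th indeterminate to the sum of the `chain k` over the
positions `k` at which the word `w` has the letter `i`. -/
def wordValue (w : List ℕ) (i : ℕ) : Op :=
  ∑ k ∈ Finset.range w.length, if w[k]? = some i then chain k else 0

theorem wordValue_mem (w : List ℕ) (i : ℕ) : wordValue w i ∈ gsLie := by
  refine sum_mem fun k _ => ?_
  split_ifs
  · exact chain_mem k
  · exact gsLie.zero_mem

theorem wordValue_marked_zero (w : List ℕ) (i n : ℕ) : wordValue w i (marked n 0) = 0 := by
  rw [wordValue, LinearMap.sum_apply]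
  refine Finset.sum_eq_zero fun k _ => ?_
  split_ifs
  · rw [chain_marked k (Nat.zero_le n), if_neg (by omega)]
  · rfl

theorem wordValue_marked_succ (w : List ℕ) (i : ℕ) {n j : ℕ} (hj : j < w.length) (hn : j < n) :
    wordValue w i (marked n (j + 1)) = if w[j] = i then marked n j else 0 := by
  rw [wordValue, LinearMap.sum_apply, Finset.sum_eq_single j]
  · rw [List.getElem?_eq_getElem hj]
    by_cases h : w[j] = i
    · rw [if_pos (congrArg some h), if_pos h, chain_marked j hn, if_pos rfl]
    · rw [if_neg (fun h' => h (Option.some.inj h')), if_neg h, LinearMap.zero_apply]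
  · intro k _ hk
    split_ifs
    · rw [chain_marked k hn, if_neg (by omega)]
    · rfl
  · intro h
    exact absurd (Finset.mem_range.mpr hj) h

/-- Each factor moves the mark down by one block, provided its letter agrees with `w` at that
position. The two `strip`s test whether the mark has reached block `0`. The rightmost factor acts
first, hence the induction from the end of `l`. -/
theorem prod_wordValue_marked (w l : List ℕ) {j : ℕ} (hj : j ≤ w.length) :
    strip 1 (strip 2 ((l.map (wordValue w)).prod (marked w.length j))) =
      (if l = w.take j then (1 : ZMod 3) else 0) • idle w.length := by
  induction l using List.reverseRecOn generalizing j with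
  | nil =>
    rw [List.map_nil, List.prod_nil, Module.End.one_apply]
    cases j with
    | zero => rw [strip_marked_zero, List.take_zero, if_pos rfl, one_smul]
    | succ j =>
      have h : [] ≠ w.take (j + 1) := fun h => by
        have := congrArg List.length h
        simp at this
        omega
      rw [strip_marked_succ, if_neg h, zero_smul]
  | append_singleton l i ih =>
    rw [List.map_append, List.prod_append, List.map_singleton, List.prod_singleton,
      Module.End.mul_apply]
    cases j with
    | zero =>
      rw [wordValue_marked_zero, map_zero, map_zero, map_zero, List.take_zero,
        if_neg (by simp), zero_smul]
    | succ j =>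
      have ht : w.take (j + 1) = w.take j ++ [w[j]] := by simp
      rw [wordValue_marked_succ w i hj hj, ht]
      by_cases h : w[j] = i
      · rw [if_pos h, ih (by omega), h]
        simp only [List.append_cancel_right_eq]
      · rw [if_neg h, map_zero, map_zero, map_zero, if_neg, zero_smul]
        intro h'
        have h2 := (List.append_inj' h' rfl).2
        exact h (List.singleton_inj.mp h2).symm

/-- No non-zero element of the free associative algebra vanishes on the Gupta–Sidki Lie algebra. -/
theorem exists_lift_ne_zero {P : FreeAlgebra (ZMod 3) ℕ} (hP : P ≠ 0) :
    ∃ f : ℕ → Op, (∀ i, f i ∈ gsLie) ∧ FreeAlgebra.lift (ZMod 3) f P ≠ 0 := by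
  set e := FreeAlgebra.equivMonoidAlgebraFreeMonoid (R := ZMod 3) (X := ℕ) with he
  have hq : e P ≠ 0 := fun h => hP (by simpa using h)
  obtain ⟨w, hw⟩ : ∃ w, (e P).coeff w ≠ 0 := by
    by_contra! h
    exact hq (by ext w; simpa using h w)
  have hl : ∀ f : ℕ → Op, FreeAlgebra.lift (ZMod 3) f =
      (MonoidAlgebra.lift (ZMod 3) Op (FreeMonoid ℕ) (FreeMonoid.lift f)).comp e.toAlgHom := by
    intro f
    ext i
    simp [he, FreeAlgebra.equivMonoidAlgebraFreeMonoid]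
  refine ⟨wordValue w.toList, wordValue_mem _, fun h => ?_⟩
  -- Evaluating at the fully shifted tensor and stripping extracts the coefficient of `w` from any
  -- polynomial.
  have key : ∀ q : MonoidAlgebra (ZMod 3) (FreeMonoid ℕ),
      strip 1 (strip 2 (MonoidAlgebra.lift (ZMod 3) Op (FreeMonoid ℕ)
        (FreeMonoid.lift (wordValue w.toList)) q (marked w.toList.length w.toList.length))) =
      q.coeff w • idle w.toList.length := by
    intro q
    induction q using MonoidAlgebra.induction_linear with
    | zero => simp
    | add p q hp hq => simp [hp, hq, add_smul]
    | single l c =>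
      have := prod_wordValue_marked w.toList l.toList le_rfl
      rw [List.take_length] at this
      rw [MonoidAlgebra.lift_single, FreeMonoid.lift_apply, LinearMap.smul_apply, map_smul,
        map_smul, this, smul_smul]
      congr 1
      by_cases hlw : l = w
      · simp [hlw]
      · have : l.toList ≠ w.toList := fun h => hlw (FreeMonoid.toList.injective h)
        simp [hlw, this]
  have := key (e P)
  rw [hl] at h
  change MonoidAlgebra.lift (ZMod 3) Op (FreeMonoid ℕ) _ (e P) = 0 at h
  rw [h, LinearMap.zero_apply, map_zero, map_zero] at this
  exact (smul_ne_zero hw (idle_ne_zero _)) this.symm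

/-! ### Unbounded nillity -/

/-- The sum of the first `n` elements `chain k`. -/
def chainSum (n : ℕ) : Op := ∑ k ∈ Finset.range n, chain k

theorem chainSum_mem (n : ℕ) : chainSum n ∈ gsLie := sum_mem fun k _ => chain_mem k

theorem chainSum_marked_succ {n N j : ℕ} (hj : j + 1 ≤ N) :
    chainSum n (marked N (j + 1)) = if j < n then marked N j else 0 := by
  rw [chainSum, LinearMap.sum_apply]
  simp only [chain_marked _ hj, Nat.add_right_cancel_iff, Finset.sum_ite_eq,
    Finset.mem_range]

theorem chainSum_pow_marked {n N : ℕ} (hN : n ≤ N) (m : ℕ) (hm : m ≤ n) :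
    (chainSum n ^ m) (marked N m) = marked N 0 := by
  induction m with
  | zero => rfl
  | succ m ih =>
    rw [pow_succ (chainSum n), Module.End.mul_apply, chainSum_marked_succ (by omega),
      if_pos (by omega),
      ih (by omega)]

theorem chainSum_pow_ne_zero (n : ℕ) : chainSum n ^ n ≠ 0 := fun h =>
  marked_zero_ne_zero n (by
    rw [← chainSum_pow_marked le_rfl n le_rfl, h, LinearMap.zero_apply])

/-- When `z v = 0`, the second term of `[z, u] v = z (u v) - u (z v)` disappears, so `ad z` acts
through left multiplication by `z`. -/
theorem ad_pow_apply_of_apply_eq_zero {R M : Type*} [CommRing R] [AddCommGroup M] [Module R M]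
    {L : LieSubalgebra R (Module.End R M)} (z u : L) {v : M} (hv : (z : Module.End R M) v = 0)
    (m : ℕ) : ((LieAlgebra.ad R L z ^ m) u : Module.End R M) v =
      ((z : Module.End R M) ^ m) ((u : Module.End R M) v) := by
  induction m with
  | zero => rfl
  | succ m ih =>
    rw [pow_succ', Module.End.mul_apply, LieAlgebra.ad_apply, LieSubalgebra.coe_bracket,
      LieRing.of_associative_ring_bracket, LinearMap.sub_apply, Module.End.mul_apply,
      Module.End.mul_apply, ih, hv, map_zero, sub_zero, pow_succ', Module.End.mul_apply]

theorem exists_ad_pow_ne_zero_of_apply {R M : Type*} [CommRing R] [AddCommGroup M] [Module R M]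
    {L : LieSubalgebra R (Module.End R M)} {z u : Module.End R M} (hz : z ∈ L) (hu : u ∈ L) {v : M}
    (hv : z v = 0) {m : ℕ} (h : (z ^ m) (u v) ≠ 0) : ∃ z : L, LieAlgebra.ad R L z ^ m ≠ 0 :=
  ⟨⟨z, hz⟩, fun h0 => h (by
    have := ad_pow_apply_of_apply_eq_zero (⟨z, hz⟩ : L) ⟨u, hu⟩ hv m
    rw [h0] at this
    exact this.symm)⟩

theorem exists_ad_pow_ne_zero (n : ℕ) :
    ∃ z : gsLie, LieAlgebra.ad (ZMod 3) gsLie z ^ n ≠ 0 := by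
  -- The mark starts at block `n + 1`, which `chainSum n` cannot move; `chain n` brings it to block
  -- `n`, whence `n` shifts take it to block `0`.
  refine exists_ad_pow_ne_zero_of_apply (chainSum_mem n) (chain_mem n)
    (v := marked (n + 1) (n + 1)) ?_ ?_
  · rw [chainSum_marked_succ le_rfl, if_neg (lt_irrefl n)]
  · rw [chain_marked n le_rfl, if_pos rfl, chainSum_pow_marked (Nat.le_succ n) n le_rfl]
    exact marked_zero_ne_zero (n + 1)

end

end GuptaSidki

theorem mainTheorem2 :
    -- `L` is a restricted Lie algebra, the `3`-mapping being `z ↦ z³`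
    (∀ z ∈ GuptaSidki.gsLie, z ^ 3 ∈ GuptaSidki.gsLie) ∧
    -- `L` is nil: every element is nil for the `3`-mapping, and every `ad z` is nilpotent
    (∀ z ∈ GuptaSidki.gsLie, ∃ n : ℕ, z ^ 3 ^ n = 0) ∧
    (∀ z : GuptaSidki.gsLie, IsNilpotent (LieAlgebra.ad (ZMod 3) GuptaSidki.gsLie z)) ∧
    -- the nillity is unbounded, in both senses
    (∀ n : ℕ, ∃ z ∈ GuptaSidki.gsLie, z ^ 3 ^ n ≠ 0) ∧
    (∀ n : ℕ, ∃ z : GuptaSidki.gsLie, LieAlgebra.ad (ZMod 3) GuptaSidki.gsLie z ^ n ≠ 0) ∧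
    -- `L` is not nilpotent, and not even PI
    ¬ LieRing.IsNilpotent GuptaSidki.gsLie ∧
    ¬ GuptaSidki.gsLie.IsPI := by
  refine ⟨fun z => GuptaSidki.cube_mem, fun z hz => ?_, fun z => ?_,
    fun n => ⟨_, GuptaSidki.chainSum_mem _, GuptaSidki.chainSum_pow_ne_zero (3 ^ n)⟩,
    GuptaSidki.exists_ad_pow_ne_zero, fun h => ?_, ?_⟩
  · obtain ⟨n, hn⟩ := GuptaSidki.isNilpotent_of_mem hz
    exact ⟨n, pow_eq_zero_of_le (Nat.lt_pow_self (by norm_num)).le hn⟩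
  · exact LieAlgebra.isNilpotent_ad_of_isNilpotent (GuptaSidki.isNilpotent_of_mem z.2)
  · obtain ⟨k, hk⟩ := LieAlgebra.nilpotent_ad_of_nilpotent_algebra (ZMod 3) GuptaSidki.gsLie
    obtain ⟨z, hz⟩ := GuptaSidki.exists_ad_pow_ne_zero k
    exact hz (hk z)
  · rintro ⟨P, -, hP, h⟩
    obtain ⟨f, hf, hne⟩ := GuptaSidki.exists_lift_ne_zero hP
    exact hne (h f hf)
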